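/- Let $\Bbbk$ be an algebraically closed field of characteristic $0$, let $G_1,G_2$ be connected affine algebraic groups over $\Bbbk$ with Lie algebras $\mathfrak g_1,\mathfrak g_2$, and let $V_1,V_2$ be finite-dimensional rational modules of $G_1$ and $G_2$, respectively. For an affine algebraic group $G$ with Lie algebra $\mathfrak g$ and a finite-dimensional rational $G$-module $V$, put $V_{\mathsf{reg}}=\{v\in V\mid \dim G\cdot v\ge \dim G\cdot v' \text{ for all } v'\in V\}$. The codimension-$2$ condition holds for $(G:V)$ if $\operatorname{codim}_V(V\setminus V_{\mathsf{reg}})\ge 2$ (this includes the case $V_{\mathsf{reg}}=V$). For $v\in V$ let $\mathfrak g_v=\{s\in\mathfrak g\mid s\cdot v=0\}$. If there is a dense (Zariski) open subset $\Omega\subset V$ such that the subalgebras $\mathfrak g_v$, $v\in\Omega$, are all $G$-conjugate, then $(G:V)$ is said to have a generic stabiliser, and each $\mathfrak g_v$ with $v\in\Omega$ is called a generic stabiliser, denoted $\mathsf{g.s.}(\mathfrak g:V)$. **Theorem.** Let $d=\dim V_2$. Suppose that the codimension-$2$ condition holds for $(G_1\times G_2: V_1\otimes V_2)$, where $(g_1,g_2)\cdot(v_1\otimes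 v_2)=g_1v_1\otimes g_2v_2$. Suppose also that $(G_1\times G_2:V_1\otimes V_2)$ and $(G_1:V_1^{\oplus d})$ have generic stabilisers and that these coincide as Lie algebras, that is, $$\mathsf{g.s.}(\mathfrak g_1\times\mathfrak g_2: V_1\otimes V_2)\simeq\mathsf{g.s.}(\mathfrak g_1: V_1^{\oplus d}).$$ (In particular, this holds if they are equal as subalgebras of $\mathfrak g_1\times\mathfrak g_2\supset\mathfrak g_1$.) Then the codimension-$2$ condition also holds for $(G_1: V_1^{\oplus d})$. -/

import Mathlib

open scoped TensorProduct

namespace CodimTwo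

universe u v w

noncomputable section

/-! ### Zariski topology and dimension on a set with a given ring of regular functions -/

section Zariski

variable {k : Type u} [Field k] {X : Type v} {Y : Type w}

/-- The Zariski topology defined by a `k`-algebra `A` of functions on `X`: the sets
`{x | f x ≠ 0}`, `f ∈ A`, form a basis of open sets. -/
@[reducible] def zariski (A : Subalgebra k (X → k)) : TopologicalSpace X :=
  TopologicalSpace.generateFrom {U | ∃ f ∈ A, U = {x | f x ≠ 0}}

/-- The ideal of the functions in `A` that vanish on `S`. -/
def vanishingIdeal (A : Subalgebra k (X → k)) (S : Set X) : Ideal A where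
  carrier := {f | ∀ x ∈ S, f.1 x = 0}
  add_mem' := fun {f g} hf hg x hx => by
    show f.1 x + g.1 x = 0
    rw [hf x hx, hg x hx, add_zero]
  zero_mem' := fun _ _ => rfl
  smul_mem' := fun c f hf x hx => by
    show c.1 x * f.1 x = 0
    rw [hf x hx, mul_zero]

/-- The dimension of (the Zariski closure of) `S`, that is, the Krull dimension of the
coordinate ring `A / I(S)` of the closure. It is `⊥` if `S` is empty. -/
def zariskiDim (A : Subalgebra k (X → k)) (S : Set X) : WithBot ℕ∞ :=
  ringKrullDim (A ⧸ vanishingIdeal A S)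

/-- Pulling back `k`-valued functions along a map. -/
def pullback (k : Type u) [Field k] (φ : X → Y) : (Y → k) →ₐ[k] (X → k) where
  toFun f := fun x => f (φ x)
  map_one' := rfl
  map_mul' _ _ := rfl
  map_zero' := rfl
  map_add' _ _ := rfl
  commutes' _ := rfl

/-- The algebra of regular functions on a product: it is generated by the pull-backs of the
regular functions on the two factors. -/
def prodAlg (A : Subalgebra k (X → k)) (B : Subalgebra k (Y → k)) :
    Subalgebra k (X × Y → k) :=
  A.map (pullback k Prod.fst) ⊔ B.map (pullback k Prod.snd)

/-- To map `prodAlg A B` into a subalgebra by a pull-back, it suffices to map `A` and `B`. -/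
theorem pullback_mem_of_prodAlg {Z : Type*} {A : Subalgebra k (X → k)} {B : Subalgebra k (Y → k)}
    {C : Subalgebra k (Z → k)} (φ : Z → X × Y)
    (hA : ∀ a ∈ A, (fun z => a (φ z).1) ∈ C) (hB : ∀ b ∈ B, (fun z => b (φ z).2) ∈ C)
    {F : X × Y → k} (hF : F ∈ prodAlg A B) : (fun z => F (φ z)) ∈ C := by
  have h : prodAlg A B ≤ C.comap (pullback k φ) := by
    refine sup_le ?_ ?_
    · rintro _ ⟨a, ha, rfl⟩
      exact hA a ha
    · rintro _ ⟨b, hb, rfl⟩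
      exact hB b hb
  exact h hF

/-- The algebra `k[V]` of polynomial functions on a vector space, generated by the linear forms. -/
def polyFun (k : Type u) [Field k] (V : Type v) [AddCommGroup V] [Module k V] : Subalgebra k (V → k) :=
  Algebra.adjoin k (Set.range fun ℓ : Module.Dual k V => (fun v => ℓ v))

end Zariski

/-! ### Affine algebraic groups -/

section Groups

/-- The structure of an affine algebraic group over `k` on a group `G`: a finitely generated
algebra `k[G]` of `k`-valued functions on `G` such that `G` is the set of all algebra
homomorphisms `k[G] → k` (so that `G` is an affine variety), and for which multiplication
`G × G → G` and inversion `G → G` are morphisms of varieties. -/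
class AffineAlgebraicGroup (k : Type u) [Field k] (G : Type v) [Group G] where
  /-- the algebra `k[G]` of regular functions -/
  coordRing : Subalgebra k (G → k)
  fg : coordRing.FG
  eval_bijective : Function.Bijective
    (fun g : G => ((Pi.evalAlgHom k (fun _ : G => k) g).comp coordRing.val : coordRing →ₐ[k] k))
  mul_regular : ∀ f ∈ coordRing,
    (fun p : G × G => f (p.1 * p.2)) ∈ prodAlg coordRing coordRing
  inv_regular : ∀ f ∈ coordRing, (fun g : G => f g⁻¹) ∈ coordRing

variable (k : Type u) [Field k] (G : Type v) [Group G] [AffineAlgebraicGroup k G]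

/-- The algebra `k[G]` of regular functions on an affine algebraic group. -/
abbrev coordRing : Subalgebra k (G → k) := AffineAlgebraicGroup.coordRing

/-- `G` is connected in its Zariski topology. -/
def IsZariskiConnected : Prop :=
  @ConnectedSpace G (zariski (coordRing k G))

variable {k G}

theorem const_mem {X : Type*} (A : Subalgebra k (X → k)) (c : k) : (fun _ => c) ∈ A :=
  A.algebraMap_mem c

theorem left_mem (g : G) {f : G → k} (hf : f ∈ coordRing k G) :
    (fun x => f (g * x)) ∈ coordRing k G :=
  pullback_mem_of_prodAlg (fun x : G => (g, x)) (fun a _ => const_mem _ (a g))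
    (fun _ hb => hb) (AffineAlgebraicGroup.mul_regular f hf)

theorem right_mem (g : G) {f : G → k} (hf : f ∈ coordRing k G) :
    (fun x => f (x * g)) ∈ coordRing k G :=
  pullback_mem_of_prodAlg (fun x : G => (x, g)) (fun _ ha => ha)
    (fun b _ => const_mem _ (b g)) (AffineAlgebraicGroup.mul_regular f hf)

variable (k)

/-- Left translation of regular functions, `f ↦ (x ↦ f (g x))`. -/
def leftTranslate (g : G) : coordRing k G →ₐ[k] coordRing k G :=
  ((pullback k (fun x : G => g * x)).comp (coordRing k G).val).codRestrict (coordRing k G)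
    (fun f => left_mem g f.2)

/-- Right translation of regular functions, `f ↦ (x ↦ f (x g))`. -/
def rightTranslate (g : G) : coordRing k G →ₐ[k] coordRing k G :=
  ((pullback k (fun x : G => x * g)).comp (coordRing k G).val).codRestrict (coordRing k G)
    (fun f => right_mem g f.2)

variable {k}

@[simp] theorem leftTranslate_apply (g : G) (f : coordRing k G) (x : G) :
    (leftTranslate k g f).1 x = f.1 (g * x) := rfl

@[simp] theorem rightTranslate_apply (g : G) (f : coordRing k G) (x : G) :
    (rightTranslate k g f).1 x = f.1 (x * g) := rfl

theorem coordRing_ext {f f' : coordRing k G} (h : ∀ x, f.1 x = f'.1 x) : f = f' :=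
  Subtype.ext (funext h)

variable (k G)

/-- The Lie algebra of `G`: the left-invariant derivations of `k[G]`, with the commutator. -/
def LieAlg : LieSubalgebra k (Derivation k (coordRing k G) (coordRing k G)) where
  carrier := {D | ∀ (g : G) (f : coordRing k G),
    D (leftTranslate k g f) = leftTranslate k g (D f)}
  add_mem' := fun {D E} hD hE g f => by
    rw [Derivation.add_apply, Derivation.add_apply, hD g f, hE g f, map_add]
  zero_mem' := fun g f => by simp
  smul_mem' := fun c D hD g f => by
    rw [Derivation.smul_apply, Derivation.smul_apply, hD g f, map_smul]
  lie_mem' := fun {D E} hD hE g f => by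
    rw [Derivation.commutator_apply, Derivation.commutator_apply, hE g f, hD g f, hD g (E f),
      hE g (D f), map_sub]

variable {k G}

/-- The adjoint action: `Ad g D = R_g ∘ D ∘ R_{g⁻¹}`, where `R_g` is right translation of functions.
On tangent vectors at the identity it is the differential of `x ↦ g x g⁻¹`. -/
def Ad (g : G) (D : LieAlg k G) : LieAlg k G :=
  ⟨Derivation.mk' ((rightTranslate k g).toLinearMap ∘ₗ (D.1 : coordRing k G →ₗ[k] coordRing k G) ∘ₗ
      (rightTranslate k g⁻¹).toLinearMap) (fun a b => by
      have h : ∀ c : coordRing k G, rightTranslate k g (rightTranslate k g⁻¹ c) = c :=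
        fun c => coordRing_ext fun x => by simp
      simp [h]), by
    intro h f
    have hc : ∀ (y : G) (c : coordRing k G),
        rightTranslate k y (leftTranslate k h c) = leftTranslate k h (rightTranslate k y c) :=
      fun y c => coordRing_ext fun x => by simp [mul_assoc]
    show rightTranslate k g (D.1 (rightTranslate k g⁻¹ (leftTranslate k h f))) =
      leftTranslate k h (rightTranslate k g (D.1 (rightTranslate k g⁻¹ f)))
    rw [hc, D.2 h, hc]⟩

/-- Two subalgebras of the Lie algebra of `G` are `G`-conjugate. -/
def AreConjugate (𝔞 𝔟 : LieSubalgebra k (LieAlg k G)) : Prop :=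
  ∃ g : G, (𝔟 : Set (LieAlg k G)) = Ad g '' (𝔞 : Set (LieAlg k G))

end Groups

/-! ### Products of affine algebraic groups -/

section Product

variable {k : Type u} [Field k] {G : Type v} {H : Type w} [Group G] [Group H]

theorem fst_mem {X : Type*} {Y : Type*} {A : Subalgebra k (X → k)} {B : Subalgebra k (Y → k)}
    {a : X → k} (ha : a ∈ A) : (fun p : X × Y => a p.1) ∈ prodAlg A B :=
  (le_sup_left : A.map (pullback k Prod.fst) ≤ prodAlg A B) ⟨a, ha, rfl⟩

theorem snd_mem {X : Type*} {Y : Type*} {A : Subalgebra k (X → k)} {B : Subalgebra k (Y → k)}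
    {b : Y → k} (hb : b ∈ B) : (fun p : X × Y => b p.2) ∈ prodAlg A B :=
  (le_sup_right : B.map (pullback k Prod.snd) ≤ prodAlg A B) ⟨b, hb, rfl⟩

/-- Two algebra homomorphisms out of `prodAlg A B` agree if they agree on `A` and on `B`. -/
theorem prodAlg_hom_ext {X : Type*} {Y : Type*} {A : Subalgebra k (X → k)}
    {B : Subalgebra k (Y → k)} {φ ψ : prodAlg A B →ₐ[k] k}
    (hA : ∀ (a : X → k) (ha : a ∈ A), φ ⟨_, fst_mem ha⟩ = ψ ⟨_, fst_mem ha⟩)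
    (hB : ∀ (b : Y → k) (hb : b ∈ B), φ ⟨_, snd_mem hb⟩ = ψ ⟨_, snd_mem hb⟩) : φ = ψ := by
  have h : prodAlg A B ≤ (AlgHom.equalizer φ ψ).map (prodAlg A B).val := by
    refine sup_le ?_ ?_
    · rintro _ ⟨a, ha, rfl⟩
      exact ⟨⟨_, fst_mem ha⟩, hA a ha, rfl⟩
    · rintro _ ⟨b, hb, rfl⟩
      exact ⟨⟨_, snd_mem hb⟩, hB b hb, rfl⟩
  ext F
  obtain ⟨F', hF', he⟩ := h F.2
  have : F' = F := Subtype.ext he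
  rw [← this]
  exact hF'

variable [AffineAlgebraicGroup k G] [AffineAlgebraicGroup k H]

/-- The direct product of two affine algebraic groups. -/
instance instProd : AffineAlgebraicGroup k (G × H) where
  coordRing := prodAlg (coordRing k G) (coordRing k H)
  fg := ((AffineAlgebraicGroup.fg (k := k) (G := G)).map _).sup
    ((AffineAlgebraicGroup.fg (k := k) (G := H)).map _)
  eval_bijective := by
    constructor
    · rintro ⟨g, h⟩ ⟨g', h'⟩ e
      have e1 : g = g' := (AffineAlgebraicGroup.eval_bijective (k := k) (G := G)).1 <| by
        ext a
        exact DFunLike.congr_fun e ⟨_, fst_mem a.2⟩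
      have e2 : h = h' := (AffineAlgebraicGroup.eval_bijective (k := k) (G := H)).1 <| by
        ext b
        exact DFunLike.congr_fun e ⟨_, snd_mem b.2⟩
      rw [e1, e2]
    · intro φ
      let i : coordRing k G →ₐ[k] prodAlg (coordRing k G) (coordRing k H) :=
        ((pullback k Prod.fst).comp (coordRing k G).val).codRestrict _ (fun a => fst_mem a.2)
      let j : coordRing k H →ₐ[k] prodAlg (coordRing k G) (coordRing k H) :=
        ((pullback k Prod.snd).comp (coordRing k H).val).codRestrict _ (fun b => snd_mem b.2)
      obtain ⟨g, hg⟩ := (AffineAlgebraicGroup.eval_bijective (k := k) (G := G)).2 (φ.comp i)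
      obtain ⟨h, hh⟩ := (AffineAlgebraicGroup.eval_bijective (k := k) (G := H)).2 (φ.comp j)
      refine ⟨(g, h), prodAlg_hom_ext ?_ ?_⟩
      · intro a ha
        exact DFunLike.congr_fun hg ⟨a, ha⟩
      · intro b hb
        exact DFunLike.congr_fun hh ⟨b, hb⟩
  mul_regular := fun F hF => by
    refine pullback_mem_of_prodAlg
      (fun p : (G × H) × (G × H) => (p.1.1 * p.2.1, p.1.2 * p.2.2)) ?_ ?_ hF
    · intro a ha
      exact pullback_mem_of_prodAlg (fun p : (G × H) × (G × H) => (p.1.1, p.2.1))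
        (fun c hc => fst_mem (fst_mem hc)) (fun c hc => snd_mem (fst_mem hc))
        (AffineAlgebraicGroup.mul_regular a ha)
    · intro b hb
      exact pullback_mem_of_prodAlg (fun p : (G × H) × (G × H) => (p.1.2, p.2.2))
        (fun c hc => fst_mem (snd_mem hc)) (fun c hc => snd_mem (snd_mem hc))
        (AffineAlgebraicGroup.mul_regular b hb)
  inv_regular := fun F hF =>
    pullback_mem_of_prodAlg (fun p : G × H => (p.1⁻¹, p.2⁻¹))
      (fun a ha => fst_mem (AffineAlgebraicGroup.inv_regular a ha))
      (fun b hb => snd_mem (AffineAlgebraicGroup.inv_regular b hb)) hF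

end Product

/-! ### Rational representations -/

section Representations

variable {k : Type u} [Field k] {G : Type v} [Group G] [AffineAlgebraicGroup k G]
  {V : Type w} [AddCommGroup V] [Module k V]

/-- A representation of `G` on `V` (finite-dimensional in all uses below) is rational if all its
matrix coefficients `g ↦ ℓ (g • v)` are regular functions on `G`. -/
class IsRational (ρ : Representation k G V) : Prop where
  coeff_mem : ∀ (ℓ : Module.Dual k V) (v : V), (fun g => ℓ (ρ g v)) ∈ coordRing k G

/-- The matrix coefficient `g ↦ ℓ (g • v)` as an element of `k[G]`. -/
def coeff (ρ : Representation k G V) [IsRational ρ] (ℓ : Module.Dual k V) (v : V) :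
    coordRing k G :=
  ⟨fun g => ℓ (ρ g v), IsRational.coeff_mem ℓ v⟩

variable [FiniteDimensional k V]

/-- `D · v` for `D` in the Lie algebra of `G`: the vector such that `ℓ (D · v)` is, for every
linear form `ℓ`, the derivative at the identity of `g ↦ ℓ (g • v)` in the direction `D`. -/
def lieAct (ρ : Representation k G V) [IsRational ρ] (D : LieAlg k G) (v : V) : V :=
  (Module.evalEquiv k V).symm
    { toFun := fun ℓ => (D.1 (coeff ρ ℓ v)).1 1
      map_add' := fun ℓ ℓ' => by
        have : coeff ρ (ℓ + ℓ') v = coeff ρ ℓ v + coeff ρ ℓ' v := rfl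
        rw [this, map_add]; rfl
      map_smul' := fun c ℓ => by
        have : coeff ρ (c • ℓ) v = c • coeff ρ ℓ v := rfl
        rw [this, Derivation.map_smul]; rfl }

theorem apply_lieAct (ρ : Representation k G V) [IsRational ρ] (D : LieAlg k G) (v : V)
    (ℓ : Module.Dual k V) : ℓ (lieAct ρ D v) = (D.1 (coeff ρ ℓ v)).1 1 := by
  rw [lieAct, Module.apply_evalEquiv_symm_apply]
  rfl

theorem derivation_coeff (ρ : Representation k G V) [IsRational ρ] (D : LieAlg k G) (v : V)
    (ℓ : Module.Dual k V) : D.1 (coeff ρ ℓ v) = coeff ρ ℓ (lieAct ρ D v) := by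
  refine coordRing_ext fun g => ?_
  have h1 : leftTranslate k g (coeff ρ ℓ v) = coeff ρ (ℓ ∘ₗ ρ g) v :=
    coordRing_ext fun x => by simp [coeff]
  have h2 : (leftTranslate k g (D.1 (coeff ρ ℓ v))).1 1 = (D.1 (coeff ρ ℓ v)).1 g := by simp
  rw [← h2, ← D.2 g, h1, ← apply_lieAct]
  rfl

theorem lieAct_ext {x y : V} (h : ∀ ℓ : Module.Dual k V, ℓ x = ℓ y) : x = y :=
  (Module.evalEquiv k V).injective (LinearMap.ext h)

attribute [local instance 100] LieRing.ofAssociativeRing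

/-- The differential `𝔤 → 𝔤𝔩(V)` of a rational representation of `G` on `V`. -/
def differential (ρ : Representation k G V) [IsRational ρ] : LieAlg k G →ₗ⁅k⁆ Module.End k V where
  toFun D :=
    { toFun := lieAct ρ D
      map_add' := fun v w => lieAct_ext (k := k) fun ℓ => by
        have : coeff ρ ℓ (v + w) = coeff ρ ℓ v + coeff ρ ℓ w :=
          coordRing_ext fun x => by simp [coeff]
        rw [map_add, apply_lieAct, apply_lieAct, apply_lieAct, this, map_add]; rfl
      map_smul' := fun c v => lieAct_ext (k := k) fun ℓ => by
        have : coeff ρ ℓ (c • v) = c • coeff ρ ℓ v :=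
          coordRing_ext fun x => by simp [coeff]
        rw [RingHom.id_apply, map_smul, apply_lieAct, apply_lieAct, this, Derivation.map_smul]; rfl }
  map_add' D E := LinearMap.ext fun v => lieAct_ext (k := k) fun ℓ => by
    show ℓ (lieAct ρ (D + E) v) = ℓ (lieAct ρ D v + lieAct ρ E v)
    rw [LinearMap.map_add ℓ, apply_lieAct, apply_lieAct, apply_lieAct]; rfl
  map_smul' c D := LinearMap.ext fun v => lieAct_ext (k := k) fun ℓ => by
    show ℓ (lieAct ρ (c • D) v) = ℓ (c • lieAct ρ D v)
    rw [LinearMap.map_smul ℓ, apply_lieAct, apply_lieAct]; rfl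
  map_lie' {D E} := LinearMap.ext fun v => lieAct_ext (k := k) fun ℓ => by
    show ℓ (lieAct ρ ⁅D, E⁆ v) = ℓ (lieAct ρ D (lieAct ρ E v) - lieAct ρ E (lieAct ρ D v))
    rw [LinearMap.map_sub ℓ, apply_lieAct, apply_lieAct, apply_lieAct, ← derivation_coeff, ← derivation_coeff]
    rfl

/-- The stabiliser `𝔤_v = {D ∈ 𝔤 | D · v = 0}`. -/
def lieStabiliser (ρ : Representation k G V) [IsRational ρ] (v : V) :
    LieSubalgebra k (LieAlg k G) where
  carrier := {D | differential ρ D v = 0}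
  add_mem' := fun {D E} hD hE => by
    show differential ρ (D + E) v = 0
    rw [map_add, LinearMap.add_apply, hD, hE, add_zero]
  zero_mem' := by simp
  smul_mem' := fun c D hD => by
    show differential ρ (c • D) v = 0
    rw [map_smul, LinearMap.smul_apply, hD, smul_zero]
  lie_mem' := fun {D E} hD hE => by
    show differential ρ ⁅D, E⁆ v = 0
    have hD' : differential ρ D v = 0 := hD
    have hE' : differential ρ E v = 0 := hE
    rw [LieHom.map_lie]
    show differential ρ D (differential ρ E v) - differential ρ E (differential ρ D v) = 0
    rw [hD', hE', map_zero, map_zero, sub_zero]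

/-- `𝔥` is a generic stabiliser for `(G : V)`: there is a dense Zariski open subset `Ω` of `V` such
that all stabilisers `𝔤_v`, `v ∈ Ω`, are `G`-conjugate, and `𝔥 = 𝔤_v` for some `v ∈ Ω`. -/
def IsGenericStabiliser (ρ : Representation k G V) [IsRational ρ]
    (𝔥 : LieSubalgebra k (LieAlg k G)) : Prop :=
  ∃ Ω : Set V, @IsOpen V (zariski (polyFun k V)) Ω ∧ @Dense V (zariski (polyFun k V)) Ω ∧
    (∀ v ∈ Ω, ∀ w ∈ Ω, AreConjugate (lieStabiliser ρ v) (lieStabiliser ρ w)) ∧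
    ∃ v ∈ Ω, 𝔥 = lieStabiliser ρ v

end Representations

/-! ### Regular elements and the codimension-`n` condition -/

section Codim

variable {k : Type u} [Field k] {G : Type v} [Group G] {V : Type w} [AddCommGroup V] [Module k V]

/-- The dimension of the orbit `G · v`. -/
def orbitDim (ρ : Representation k G V) (v : V) : WithBot ℕ∞ :=
  zariskiDim (polyFun k V) (Set.range fun g : G => ρ g v)

/-- The set `V_reg` of `G`-regular elements: those whose orbit has maximal dimension. -/
def regularSet (ρ : Representation k G V) : Set V :=
  {v | ∀ v' : V, orbitDim ρ v' ≤ orbitDim ρ v}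

/-- The codimension-`n` condition for `(G : V)`: `codim_V (V ∖ V_reg) ≥ n`, that is,
`dim (V ∖ V_reg) + n ≤ dim V`; it holds if `V ∖ V_reg` is empty. -/
def CodimCondition (n : ℕ) (ρ : Representation k G V) : Prop :=
  zariskiDim (polyFun k V) (regularSet ρ)ᶜ + (n : WithBot ℕ∞) ≤
    ((Module.finrank k V : ℕ) : WithBot ℕ∞)

end Codim

/-! ### The two representations -/

section Constructions

variable {k : Type u} [Field k] {G : Type v} [Group G] {V : Type w} [AddCommGroup V] [Module k V]

/-- The representation of `G` on the direct sum `V^{⊕ d}` of `d` copies of `V`. -/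
def powRep (ρ : Representation k G V) (d : ℕ) : Representation k G (Fin d → V) where
  toFun g := LinearMap.pi fun i => ρ g ∘ₗ LinearMap.proj i
  map_one' := by ext; simp
  map_mul' g h := by ext; simp

instance (ρ : Representation k G V) (d : ℕ) [AffineAlgebraicGroup k G] [IsRational ρ] :
    IsRational (powRep ρ d) where
  coeff_mem ℓ v := by
    have h : (fun g => ℓ (powRep ρ d g v)) =
        ∑ i, fun g => (ℓ ∘ₗ LinearMap.single k (fun _ : Fin d => V) i) (ρ g (v i)) := by
      funext g
      rw [Finset.sum_apply]
      conv_lhs => rw [← Finset.univ_sum_single (powRep ρ d g v), map_sum]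
      rfl
    rw [h]
    exact Subalgebra.sum_mem _ fun i _ => IsRational.coeff_mem _ _

/-- The representation of `G × H` on `V ⊗ W`, `(g, h) · (v ⊗ w) = g · v ⊗ h · w`. -/
def boxTensor {H : Type*} [Group H] {W : Type*} [AddCommGroup W] [Module k W]
    (ρ : Representation k G V) (σ : Representation k H W) :
    Representation k (G × H) (V ⊗[k] W) :=
  Representation.tprod (ρ.comp (MonoidHom.fst G H)) (σ.comp (MonoidHom.snd G H))

instance {H : Type*} [Group H] {W : Type*} [AddCommGroup W] [Module k W]
    [AffineAlgebraicGroup k G] [AffineAlgebraicGroup k H] [FiniteDimensional k V]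
    (ρ : Representation k G V) (σ : Representation k H W) [IsRational ρ] [IsRational σ] :
    IsRational (boxTensor ρ σ) where
  coeff_mem ℓ x := by
    induction x with
    | zero => simpa using const_mem (coordRing k (G × H)) 0
    | add x y hx hy =>
      have h : (fun p => ℓ (boxTensor ρ σ p (x + y))) =
          (fun p => ℓ (boxTensor ρ σ p x)) + fun p => ℓ (boxTensor ρ σ p y) := by
        funext p
        simp
      rw [h]
      exact add_mem hx hy
    | tmul v w =>
      let b := Module.finBasis k V
      have h : (fun p : G × H => ℓ (boxTensor ρ σ p (v ⊗ₜ w))) =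
          ∑ i, (fun p : G × H => b.coord i (ρ p.1 v)) *
            fun p : G × H => (ℓ ∘ₗ TensorProduct.mk k V W (b i)) (σ p.2 w) := by
        funext p
        rw [Finset.sum_apply]
        show ℓ (ρ p.1 v ⊗ₜ[k] σ p.2 w) = _
        conv_lhs => rw [← b.sum_repr (ρ p.1 v), TensorProduct.sum_tmul, map_sum]
        refine Finset.sum_congr rfl fun i _ => ?_
        rw [← TensorProduct.smul_tmul', map_smul]
        rfl
      rw [h]
      exact Subalgebra.sum_mem _ fun i _ => mul_mem
        (fst_mem (IsRational.coeff_mem (ρ := ρ) (b.coord i) v))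
        (snd_mem (IsRational.coeff_mem (ρ := σ) _ w))

end Constructions

end

end CodimTwo

open CodimTwo

/-!
In characteristic `0`, a finitely generated left invariant subalgebra `B` of `k[G]` has Krull
dimension `dim 𝔤 - dim 𝔞`, where `𝔞` consists of the left invariant derivations that kill `B`.
Indeed let `z₁, …, zₛ` be a Noether normalisation of `B`. If `𝔤 / 𝔞` had dimension greater than `s`,
some nontrivial combination `E = ∑ aᵢ Dᵢ` with coefficients in `k[G]` of derivations `Dᵢ`
independent modulo `𝔞` would kill all `zⱼ`, hence, `B` being integral over them, all of `B`;
evaluating the coefficients at a point gives a relation modulo `𝔞`. Conversely there are `s`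
derivations of `k[G]` with nonzero Jacobian determinant on the `zⱼ`, and at a point where it does
not vanish they agree with left invariant derivations.

Applied to the algebra generated by the coordinates of an orbit map, this gives
`dim G·v = dim 𝔤 - dim 𝔤_v`. Ranks are lower semicontinuous, so `v` is regular precisely when
`dim 𝔤_v` is at most the dimension of a generic stabiliser. As a `G₁`-module, `V₁ ⊗ V₂` is `V₁^d`,
so the stabiliser of a vector in `𝔤₁` embeds in its stabiliser in `𝔤₁ × 𝔤₂`. When the generic
stabilisers have the same dimension, a vector regular for `G₁ × G₂` is therefore regular for `G₁`,
and passing to `G₁` can only shrink the complement of the regular set.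
-/

namespace CodimTwo

section Dimension

theorem ringKrullDim_eq_of_isIntegral {R S : Type*} [CommRing R] [CommRing S] [Algebra R S]
    [Algebra.IsIntegral R S] (hinj : Function.Injective (algebraMap R S)) :
    ringKrullDim S = ringKrullDim R := by
  refine le_antisymm
    (Order.krullDim_le_of_strictMono (PrimeSpectrum.comap (algebraMap R S)) fun _ _ hpq =>
      Ideal.IsIntegral.comap_lt_comap hpq) (iSup_le fun l => ?_)
  have hker : RingHom.ker (algebraMap R S) ≤ l.head.asIdeal := by
    rw [(RingHom.injective_iff_ker_eq_bot _).1 hinj]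
    exact bot_le
  obtain ⟨Q, -, hQ, hQl⟩ := Ideal.exists_ideal_over_prime_of_isIntegral l.head.asIdeal ⊥ hker
  have : Q.LiesOver l.head.asIdeal := ⟨hQl.symm⟩
  obtain ⟨L, hL, -, -⟩ := Ideal.exists_ltSeries_of_hasGoingUp l Q
  rw [← hL]
  exact Order.LTSeries.length_le_krullDim L

theorem exists_algebraicIndependent_isIntegral_adjoin (k B : Type*) [Field k] [CommRing B]
    [Nontrivial B] [Algebra k B] [Algebra.FiniteType k B] :
    ∃ (s : ℕ) (z : Fin s → B), AlgebraicIndependent k z ∧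
      Algebra.IsIntegral (Algebra.adjoin k (Set.range z)) B := by
  obtain ⟨s, φ, hinj, hint⟩ := exists_integral_inj_algHom_of_fg k B
  have hrange : Algebra.adjoin k (Set.range (φ ∘ MvPolynomial.X)) = φ.range := by
    rw [Set.range_comp, ← AlgHom.map_adjoin, MvPolynomial.adjoin_range_X, Algebra.map_top]
  refine ⟨s, φ ∘ MvPolynomial.X,
    (MvPolynomial.algebraicIndependent_X (Fin s) k).map' (f := φ) hinj, ⟨fun b => ?_⟩⟩
  rw [hrange]
  obtain ⟨p, hp, hpb⟩ := hint b
  exact ⟨p.map φ.rangeRestrict.toRingHom, hp.map _, by rw [Polynomial.eval₂_map, ← hpb]; rfl⟩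

theorem ringKrullDim_eq_of_algebraicIndependent {k B : Type*} [Field k] [CommRing B] [Algebra k B]
    {s : ℕ} {z : Fin s → B} (hz : AlgebraicIndependent k z)
    [Algebra.IsIntegral (Algebra.adjoin k (Set.range z)) B] : ringKrullDim B = s := by
  rw [ringKrullDim_eq_of_isIntegral (R := Algebra.adjoin k (Set.range z)) Subtype.val_injective,
    ← ringKrullDim_eq_of_ringEquiv hz.aevalEquiv.toRingEquiv,
    MvPolynomial.ringKrullDim_of_isNoetherianRing, ringKrullDim_eq_zero_of_field]
  simp

theorem exists_algebraicIndependent_isIntegral_adjoin_of_fg {k C : Type*} [Field k] [CommRing C]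
    [Nontrivial C] [Algebra k C] {B : Subalgebra k C} (hB : B.FG) :
    ∃ (s : ℕ) (z : Fin s → C), AlgebraicIndependent k z ∧ (∀ i, z i ∈ B) ∧
      (∀ b ∈ B, IsIntegral (Algebra.adjoin k (Set.range z)) b) ∧ ringKrullDim B = s := by
  have := B.fg_iff_finiteType.1 hB
  obtain ⟨s, z, hz, hint⟩ := exists_algebraicIndependent_isIntegral_adjoin k B
  refine ⟨s, B.val ∘ z, hz.map' Subtype.val_injective, fun i => (z i).2, fun b hb => ?_,
    ringKrullDim_eq_of_algebraicIndependent hz⟩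
  have hadjoin : (Algebra.adjoin k (Set.range z)).map B.val =
      Algebra.adjoin k (Set.range (B.val ∘ z)) := by
    rw [AlgHom.map_adjoin, Set.range_comp]
  rw [← hadjoin]
  exact (hint.isIntegral ⟨b, hb⟩).map_of_comp_eq
    ((Algebra.adjoin k (Set.range z)).equivMapOfInjective B.val Subtype.val_injective).toRingHom
    B.val.toRingHom rfl

end Dimension

section Derivations

variable {R A : Type*} [CommRing R] [CommRing A] [Algebra R A]

theorem derivation_mul_eq_zero [IsReduced A] (E : Derivation R A A) {c x : A} (h : c * x = 0) :
    E c * x = 0 := by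
  have hE : c * E x + x * E c = 0 := by
    rw [← smul_eq_mul, ← smul_eq_mul, ← E.leibniz, h, map_zero]
  refine eq_zero_of_pow_eq_zero (n := 2) ?_
  linear_combination x * E c * hE - E x * E c * h

theorem aeval_iterate_derivative_mul_derivation_eq_zero [IsReduced A] (E : Derivation R A A)
    {b : A} {p : Polynomial R} (hp : Polynomial.aeval b p = 0) (n : ℕ) :
    Polynomial.aeval b (Polynomial.derivative^[n] p) * E b = 0 := by
  induction n with
  | zero => simp [hp]
  | succ n ih =>
    have h := derivation_mul_eq_zero E ih
    rw [E.map_aeval, smul_eq_mul, mul_assoc] at h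
    rw [Function.iterate_succ_apply']
    refine eq_zero_of_pow_eq_zero (n := 2) ?_
    linear_combination Polynomial.aeval b (Polynomial.derivative (Polynomial.derivative^[n] p)) * h

theorem iterate_derivative_natDegree_of_monic {p : Polynomial R} (hp : p.Monic) :
    Polynomial.derivative^[p.natDegree] p = (p.natDegree.factorial : Polynomial R) := by
  have hdeg : (Polynomial.derivative^[p.natDegree] p).natDegree = 0 := by
    simpa using Polynomial.natDegree_iterate_derivative p p.natDegree
  rw [Polynomial.eq_C_of_natDegree_eq_zero hdeg, Polynomial.coeff_iterate_derivative]
  simp [hp.coeff_natDegree, Nat.descFactorial_self]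

theorem derivation_eq_zero_of_isIntegral [IsReduced A] [IsAddTorsionFree A] (E : Derivation R A A)
    {b : A} (hb : IsIntegral R b) : E b = 0 := by
  obtain ⟨p, hp, hpb⟩ := hb
  have h := aeval_iterate_derivative_mul_derivation_eq_zero E hpb p.natDegree
  rw [iterate_derivative_natDegree_of_monic hp, map_natCast, ← nsmul_eq_mul] at h
  exact (smul_eq_zero_iff_right p.natDegree.factorial_ne_zero).1 h

/-- The elements killed by a derivation. -/
def constants (E : Derivation R A A) : Subalgebra R A where
  carrier := {a | E a = 0}
  add_mem' {a b} ha hb := by simp_all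
  mul_mem' {a b} ha hb := by simp_all
  algebraMap_mem' := E.map_algebraMap

theorem isIntegral_constants_iff [IsReduced A] [IsAddTorsionFree A] (E : Derivation R A A)
    {b : A} : IsIntegral (constants E) b ↔ b ∈ constants E := by
  refine ⟨fun hb => ?_, fun hb => isIntegral_algebraMap (x := (⟨b, hb⟩ : constants E))⟩
  have hE : ∀ c : constants E, E c = 0 := fun c => c.2
  exact derivation_eq_zero_of_isIntegral (R := constants E) (Derivation.mk'
    { toFun := E
      map_add' := map_add E
      map_smul' c a := by simp [Subalgebra.smul_def, hE] } E.leibniz) hb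

theorem derivation_eq_zero_of_isIntegral_adjoin [IsReduced A] [IsAddTorsionFree A]
    {E : Derivation R A A} {s : Set A} (hs : ∀ x ∈ s, E x = 0) {b : A}
    (hb : IsIntegral (Algebra.adjoin R s) b) : E b = 0 := by
  have hle : Algebra.adjoin R s ≤ constants E := Algebra.adjoin_le hs
  algebraize [(Subalgebra.inclusion hle).toRingHom]
  have : IsScalarTower (Algebra.adjoin R s) (constants E) A := .of_algebraMap_eq fun _ => rfl
  exact (isIntegral_constants_iff E).1 hb.tower_top

theorem exists_ne_zero_sum_mul_derivation_eq_zero [Nontrivial A] {m s : ℕ} (hlt : s < m)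
    (D : Fin m → Derivation R A A) (z : Fin s → A) :
    ∃ a : Fin m → A, a ≠ 0 ∧ ∀ j, ∑ i, a i * D i (z j) = 0 := by
  let T := Matrix.mulVecLin (Matrix.of fun j i => D i (z j))
  have hT : ¬ Function.Injective T := fun h => hlt.not_ge (le_of_fin_injective A T h)
  simp only [injective_iff_map_eq_zero, not_forall] at hT
  obtain ⟨a, ha, ha0⟩ := hT
  refine ⟨a, ha0, fun j => ?_⟩
  simpa [T, Matrix.mulVec, dotProduct, mul_comm] using congrFun ha j

end Derivations

section DualDerivations

theorem exists_derivation_extension_of_formallyEtale {R S T M : Type*} [CommRing R] [CommRing S]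
    [CommRing T] [Algebra R S] [Algebra S T] [Algebra R T] [IsScalarTower R S T]
    [Algebra.FormallyEtale S T] [AddCommGroup M] [Module R M] [Module S M] [Module T M]
    [IsScalarTower S T M] [IsScalarTower R S M] [IsScalarTower R T M] (d : Derivation R S M) :
    ∃ d' : Derivation R T M, ∀ s, d' (algebraMap S T s) = d s := by
  refine ⟨(d.liftKaehlerDifferential.liftBaseChange T ∘ₗ
    (KaehlerDifferential.tensorKaehlerEquivOfFormallyEtale R S T).symm.toLinearMap).compDer
      (KaehlerDifferential.D R T), fun s => ?_⟩
  simp [KaehlerDifferential.tensorKaehlerEquivOfFormallyEtale_symm_D_algebraMap]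

variable {k : Type*} [Field k] [CharZero k]

open scoped IntermediateField.algebraAdjoinAdjoin in
theorem formallyEtale_adjoin_of_isTranscendenceBasis {L ι : Type*} [Field L] [Algebra k L]
    {x : ι → L} (hx : IsTranscendenceBasis k x) :
    Algebra.FormallyEtale (Algebra.adjoin k (Set.range x)) L := by
  have : Algebra.FormallyEtale (Algebra.adjoin k (Set.range x))
      (IntermediateField.adjoin k (Set.range x)) := .of_isLocalization (nonZeroDivisors _)
  have : Algebra.IsAlgebraic (IntermediateField.adjoin k (Set.range x)) L := hx.isAlgebraic_field
  have : Algebra.FormallyEtale (IntermediateField.adjoin k (Set.range x)) L :=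
    .of_isSeparable _ L
  exact .comp _ (IntermediateField.adjoin k (Set.range x)) _

theorem exists_derivation_of_isTranscendenceBasis {L ι : Type*} [Field L] [Algebra k L]
    {x : ι → L} (hx : IsTranscendenceBasis k x) (c : ι → L) :
    ∃ δ : Derivation k L L, ∀ i, δ (x i) = c i := by
  have := formallyEtale_adjoin_of_isTranscendenceBasis hx
  algebraize [(MvPolynomial.aeval x : MvPolynomial ι k →ₐ[k] L).toRingHom,
    hx.1.aevalEquiv.toAlgHom.toRingHom]
  have : IsScalarTower k (MvPolynomial ι k) L := .of_algebraMap_eq fun r => by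
    simp [RingHom.algebraMap_toAlgebra]
  have : IsScalarTower (MvPolynomial ι k) (Algebra.adjoin k (Set.range x)) L :=
    .of_algebraMap_eq fun _ => by simp [RingHom.algebraMap_toAlgebra]
  have : Algebra.FormallyEtale (MvPolynomial ι k) (Algebra.adjoin k (Set.range x)) :=
    .of_equiv (AlgEquiv.ofBijective (Algebra.ofId _ _) hx.1.aevalEquiv.bijective)
  have : Algebra.FormallyEtale (MvPolynomial ι k) L := .comp _ (Algebra.adjoin k (Set.range x)) _
  obtain ⟨δ, hδ⟩ := exists_derivation_extension_of_formallyEtale (T := L)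
    (MvPolynomial.mkDerivation k c)
  refine ⟨δ, fun i => ?_⟩
  simpa [RingHom.algebraMap_toAlgebra] using hδ (MvPolynomial.X i)

theorem exists_derivation_of_algebraicIndependent {L ι : Type*} [Field L] [Algebra k L]
    {z : ι → L} (hz : AlgebraicIndependent k z) (c : ι → L) :
    ∃ δ : Derivation k L L, ∀ i, δ (z i) = c i := by
  obtain ⟨t, ht, hb⟩ := exists_isTranscendenceBasis_superset hz.to_subtype_range
  let z' : ι → t := fun i => ⟨z i, ht ⟨i, rfl⟩⟩
  have hz' : Function.Injective z' := fun i j h => hz.injective (congrArg Subtype.val h)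
  obtain ⟨δ, hδ⟩ := exists_derivation_of_isTranscendenceBasis hb (Function.extend z' c 0)
  exact ⟨δ, fun i => (hδ (z' i)).trans (hz'.extend_apply c 0 i)⟩

theorem exists_derivation_eq_smul_of_isLocalization {R A S : Type*} [CommRing R] [CommRing A]
    [Algebra R A] [Module.FinitePresentation A Ω[A⁄R]] (M : Submonoid A) [CommRing S] [Algebra R S]
    [Algebra A S] [IsScalarTower R A S] [IsLocalization M S] (d : Derivation R A S) :
    ∃ (m : M) (δ : Derivation R A A), ∀ a, algebraMap A S (δ a) = m • d a := by
  obtain ⟨h, m, hm⟩ := Module.FinitePresentation.exists_lift_of_isLocalizedModule M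
    (Algebra.linearMap A S) d.liftKaehlerDifferential
  exact ⟨m, h.compDer (KaehlerDifferential.D R A), fun a => by
    simpa using LinearMap.congr_fun hm (KaehlerDifferential.D R A a)⟩

theorem exists_minimalPrime_algebraicIndependent_localization {R A ι : Type*} [CommRing R]
    [IsDomain R] [CommRing A] [Algebra R A] {z : ι → A} (hz : AlgebraicIndependent R z) :
    ∃ (P : Ideal A) (_ : P.IsPrime), P ∈ minimalPrimes A ∧
      AlgebraicIndependent R (algebraMap A (Localization.AtPrime P) ∘ z) := by
  let φ := (MvPolynomial.aeval z : MvPolynomial ι R →ₐ[R] A).toRingHom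
  have hφ : (⊥ : Ideal A).comap φ = ⊥ := (RingHom.injective_iff_ker_eq_bot φ).1 hz
  have hbot : ⊥ ∈ ((⊥ : Ideal A).comap φ).minimalPrimes := by
    simp [hφ, Ideal.minimalPrimes_eq_subsingleton_self]
  obtain ⟨P, hP, hPz⟩ := Ideal.exists_minimalPrimes_comap_eq φ ⊥ hbot
  have := hP.1.1
  refine ⟨P, hP.1.1, hP, algebraicIndependent_iff.2 fun p hp => ?_⟩
  have hpP : algebraMap A (Localization.AtPrime P) (φ p) = 0 := by
    rw [← hp]
    exact (MvPolynomial.aeval_algebraMap_apply _ z p).symm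
  rw [← Ideal.mem_bot, ← hPz, Ideal.mem_comap]
  refine (IsLocalization.AtPrime.to_map_mem_maximal_iff (Localization.AtPrime P) P (φ p)).1 ?_
  rw [hpP]
  exact zero_mem _

theorem exists_det_derivation_ne_zero {A : Type*} [CommRing A] [IsReduced A] [Algebra k A]
    [Algebra.FiniteType k A] {s : ℕ} {z : Fin s → A} (hz : AlgebraicIndependent k z) :
    ∃ δ : Fin s → Derivation k A A, (Matrix.of fun i j => δ j (z i)).det ≠ 0 := by
  -- Over the field `A_P` there are derivations dual to `z`; clearing denominators in them only
  -- makes the Jacobian matrix diagonal instead of the identity.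
  obtain ⟨P, _, hP, hzP⟩ := exists_minimalPrime_algebraicIndependent_localization hz
  let L := Localization.AtPrime P
  have : IsNoetherianRing A := Algebra.FiniteType.isNoetherianRing k A
  have : Module.FinitePresentation A Ω[A⁄k] := Module.finitePresentation_of_finite A _
  have : Ring.KrullDimLE 0 L := .of_isLocalization P hP L
  have hL : IsField L := Ring.KrullDimLE.isField_of_isReduced
  let := hL.toField
  choose δL hδL using fun j => exists_derivation_of_algebraicIndependent hzP (Pi.single j 1)
  choose m δ hδ using fun j =>
    exists_derivation_eq_smul_of_isLocalization P.primeCompl ((δL j).compAlgebraMap A)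
  have hdiag : (algebraMap A L).mapMatrix (Matrix.of fun i j => δ j (z i)) =
      Matrix.diagonal fun j => algebraMap A L (m j) := by
    ext i j
    have hij : algebraMap A L (δ j (z i)) = m j • (Pi.single j 1 : Fin s → L) i :=
      (hδ j (z i)).trans (congrArg (m j • ·) (hδL j i))
    obtain rfl | hne := eq_or_ne i j <;>
      simp [Submonoid.smul_def, Algebra.smul_def, *]
  refine ⟨δ, fun hdet => ?_⟩
  have hprod := congrArg (algebraMap A L) hdet
  rw [RingHom.map_det, hdiag, Matrix.det_diagonal, map_zero, Finset.prod_eq_zero_iff] at hprod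
  obtain ⟨j, -, hj⟩ := hprod
  exact (IsLocalization.map_units L (m j)).ne_zero hj

end DualDerivations

section LieAlgebra

variable {k : Type*} [Field k]

instance {X : Type*} (A : Subalgebra k (X → k)) : IsReduced A :=
  isReduced_of_injective A.val Subtype.val_injective

instance {X : Type*} [CharZero k] (A : Subalgebra k (X → k)) : IsAddTorsionFree A :=
  Subtype.val_injective.isAddTorsionFree (A.val : A →+ (X → k))

theorem apply_slice_mem {X Y : Type*} {A : Subalgebra k (X → k)} {B : Subalgebra k (Y → k)}
    (d : (Y → k) →ₗ[k] k) {F : X × Y → k} (hF : F ∈ prodAlg A B) :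
    (fun x => d fun y => F (x, y)) ∈ A := by
  have hF' : F ∈ Subalgebra.toSubmodule (A.map (pullback k Prod.fst)) *
      Subalgebra.toSubmodule (B.map (pullback k Prod.snd)) := by
    rwa [Subalgebra.mul_toSubmodule]
  refine Submodule.mul_induction_on hF' ?_ fun f g hf hg =>
    (funext fun x => d.map_add (fun y => f (x, y)) fun y => g (x, y)) ▸ A.add_mem hf hg
  rintro _ ⟨a, ha, rfl⟩ _ ⟨b, -, rfl⟩
  exact (funext fun x => (d.map_smul (a x) b).trans (mul_comm _ _) :
    (fun x => d fun y => a x * b y) = d b • a) ▸ A.smul_mem ha _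

variable {G : Type*} [Group G] [AffineAlgebraicGroup k G]

instance : Algebra.FiniteType k (coordRing k G) :=
  (Subalgebra.fg_iff_finiteType _).1 AffineAlgebraicGroup.fg

instance : Nontrivial (coordRing k G) :=
  ⟨0, 1, fun h => zero_ne_one (congrFun (congrArg Subtype.val h) (1 : G))⟩

theorem exists_apply_ne_zero {f : coordRing k G} (hf : f ≠ 0) : ∃ g, f.1 g ≠ 0 := by
  contrapose! hf
  exact coordRing_ext hf

theorem leftTranslate_leftTranslate (g h : G) (f : coordRing k G) :
    leftTranslate k h (leftTranslate k g f) = leftTranslate k (g * h) f :=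
  coordRing_ext fun x => by simp [mul_assoc]

theorem leftTranslate_one (f : coordRing k G) : leftTranslate k 1 f = f :=
  coordRing_ext fun x => by simp

theorem lieAlg_apply (D : LieAlg k G) (f : coordRing k G) (g : G) :
    (D.1 f).1 g = (D.1 (leftTranslate k g f)).1 1 := by
  rw [D.2 g f, leftTranslate_apply, mul_one]

theorem lieAlg_ext {D E : LieAlg k G} (h : ∀ f, (D.1 f).1 1 = (E.1 f).1 1) : D = E :=
  Subtype.ext <| Derivation.ext fun f => coordRing_ext fun g => by
    rw [lieAlg_apply D, lieAlg_apply E, h]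

theorem lieAlg_ext_of_adjoin_eq_top {s : Set (coordRing k G)} (hs : Algebra.adjoin k s = ⊤)
    {D E : LieAlg k G} (h : ∀ f ∈ s, (D.1 f).1 1 = (E.1 f).1 1) : D = E := by
  refine lieAlg_ext fun f => ?_
  have hf : f ∈ Algebra.adjoin k s := hs ▸ Algebra.mem_top
  induction hf using Algebra.adjoin_induction with
  | mem f hf => exact h f hf
  | algebraMap c => simp
  | add a b _ _ ha hb => simp [ha, hb]
  | mul a b _ _ ha hb => simp [ha, hb]

theorem apply_leftTranslate_mem (d : coordRing k G →ₗ[k] k) (f : coordRing k G) :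
    (fun x => d (leftTranslate k x f)) ∈ coordRing k G := by
  obtain ⟨d', hd'⟩ := LinearMap.exists_extend (p := Subalgebra.toSubmodule (coordRing k G)) d
  have hd : ∀ x, d (leftTranslate k x f) = d' fun y => f.1 (x * y) := fun x =>
    (LinearMap.congr_fun hd' (leftTranslate k x f)).symm
  simpa only [hd] using apply_slice_mem d' (AffineAlgebraicGroup.mul_regular f.1 f.2)

/-- The left invariant derivation of `k[G]` whose value at the identity is a given tangent vector,
that is, a linear form `d` on `k[G]` with `d (a b) = a(1) d b + b(1) d a`. -/
noncomputable def leftInvariantDerivation (d : coordRing k G →ₗ[k] k)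
    (hd : ∀ a b : coordRing k G, d (a * b) = a.1 1 * d b + b.1 1 * d a) : LieAlg k G :=
  ⟨Derivation.mk'
    { toFun f := ⟨fun x => d (leftTranslate k x f), apply_leftTranslate_mem d f⟩
      map_add' a b := coordRing_ext fun x => by simp
      map_smul' c a := coordRing_ext fun x => by simp }
    fun a b => coordRing_ext fun x => by simp [hd],
  fun g f => coordRing_ext fun x => congrArg d (leftTranslate_leftTranslate g x f)⟩

theorem leftInvariantDerivation_apply (d : coordRing k G →ₗ[k] k)
    (hd : ∀ a b : coordRing k G, d (a * b) = a.1 1 * d b + b.1 1 * d a) (f : coordRing k G)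
    (x : G) : ((leftInvariantDerivation d hd).1 f).1 x = d (leftTranslate k x f) := rfl

theorem exists_lieAlg_eq (δ : Derivation k (coordRing k G) (coordRing k G)) (g : G) :
    ∃ D : LieAlg k G, ∀ f, (D.1 f).1 g = (δ f).1 g := by
  let d : coordRing k G →ₗ[k] k :=
    { toFun f := (δ (leftTranslate k g⁻¹ f)).1 g
      map_add' a b := by simp
      map_smul' c a := by simp }
  refine ⟨leftInvariantDerivation d fun a b => by simp [d], fun f => ?_⟩
  rw [leftInvariantDerivation_apply]
  change (δ (leftTranslate k g⁻¹ (leftTranslate k g f))).1 g = _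
  rw [leftTranslate_leftTranslate, mul_inv_cancel, leftTranslate_one]

/-- The linear form `D ↦ (D f)(g)` on the Lie algebra. -/
def lieEval (g : G) (f : coordRing k G) : LieAlg k G →ₗ[k] k where
  toFun D := (D.1 f).1 g
  map_add' _ _ := rfl
  map_smul' _ _ := rfl

theorem lieEval_apply (g : G) (f : coordRing k G) (D : LieAlg k G) :
    lieEval g f D = (D.1 f).1 g := rfl

instance : FiniteDimensional k (LieAlg k G) := by
  obtain ⟨s, hs⟩ := Algebra.FiniteType.out (R := k) (A := coordRing k G)
  refine .of_injective (LinearMap.pi fun f : s => lieEval 1 f.1) fun D E h => ?_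
  exact lieAlg_ext_of_adjoin_eq_top hs fun f hf => congrFun h ⟨f, hf⟩

/-- The left invariant derivations that kill a subalgebra of `k[G]`. If the subalgebra is
generated by the coordinates of an orbit map `g ↦ g • v`, they form the stabiliser `𝔤_v`. -/
def lieAnnihilator (B : Subalgebra k (coordRing k G)) : Submodule k (LieAlg k G) where
  carrier := {D | ∀ b ∈ B, D.1 b = 0}
  add_mem' hD hE b hb := by simp [hD b hb, hE b hb]
  zero_mem' _ _ := rfl
  smul_mem' c D hD b hb := by simp [hD b hb]

theorem sum_smul_mem_lieAnnihilator {B : Subalgebra k (coordRing k G)}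
    (hB : ∀ g, ∀ b ∈ B, leftTranslate k g b ∈ B) {ι : Type*} [Fintype ι] (D : ι → LieAlg k G)
    (a : ι → coordRing k G) (h : ∀ b ∈ B, ∑ i, a i * (D i).1 b = 0) (g : G) :
    ∑ i, (a i).1 g • D i ∈ lieAnnihilator B := by
  refine fun b hb => coordRing_ext fun x => ?_
  have hx : ∀ i, ((D i).1 (leftTranslate k (x * g⁻¹) b)).1 g = lieEval x b (D i) := fun i => by
    rw [(D i).2, leftTranslate_apply, inv_mul_cancel_right, lieEval_apply]
  have hsum := congrArg (fun f => f.1 g) (h _ (hB (x * g⁻¹) b hb))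
  change lieEval x b (∑ i, (a i).1 g • D i) = 0
  simpa [hx] using hsum

section Transcendence

variable [CharZero k] {B : Subalgebra k (coordRing k G)} {s : ℕ} {z : Fin s → coordRing k G}

theorem finrank_quotient_lieAnnihilator_le (hB : ∀ g, ∀ b ∈ B, leftTranslate k g b ∈ B)
    (hz : ∀ b ∈ B, IsIntegral (Algebra.adjoin k (Set.range z)) b) :
    Module.finrank k (LieAlg k G ⧸ lieAnnihilator B) ≤ s := by
  by_contra! hlt
  let b := Module.finBasis k (LieAlg k G ⧸ lieAnnihilator B)
  choose D hD using fun i => Submodule.mkQ_surjective (lieAnnihilator B) (b i)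
  obtain ⟨a, ha, hsum⟩ := exists_ne_zero_sum_mul_derivation_eq_zero hlt (fun i => (D i).1) z
  obtain ⟨i, hi⟩ := Function.ne_iff.1 ha
  obtain ⟨g, hg⟩ := exists_apply_ne_zero hi
  let E : Derivation k (coordRing k G) (coordRing k G) := ∑ i, a i • (D i).1
  have hE : ∀ f, E f = ∑ i, a i * (D i).1 f := fun f =>
    (congrFun (map_sum (Derivation.coeFnAddMonoidHom (R := k)) (fun i => a i • (D i).1)
      Finset.univ) f).trans (Finset.sum_apply _ _ _)
  have hEz : ∀ x ∈ Set.range z, E x = 0 := by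
    rintro _ ⟨j, rfl⟩
    rw [hE, hsum]
  have hEB : ∀ b ∈ B, ∑ i, a i * (D i).1 b = 0 := fun b hb =>
    (hE b).symm.trans (derivation_eq_zero_of_isIntegral_adjoin hEz (hz b hb))
  have hrel : ∑ i, (a i).1 g • b i = 0 := by
    simp only [← hD, ← map_smul, ← map_sum]
    exact (Submodule.Quotient.mk_eq_zero _).2 (sum_smul_mem_lieAnnihilator hB D a hEB g)
  exact hg (Fintype.linearIndependent_iff.1 b.linearIndependent _ hrel i)

theorem le_finrank_quotient_lieAnnihilator (hz : AlgebraicIndependent k z) (hzB : ∀ i, z i ∈ B) :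
    s ≤ Module.finrank k (LieAlg k G ⧸ lieAnnihilator B) := by
  obtain ⟨δ, hδ⟩ := exists_det_derivation_ne_zero hz
  obtain ⟨g, hg⟩ := exists_apply_ne_zero hδ
  choose D hD using fun j => exists_lieAlg_eq (δ j) g
  let evalAt : coordRing k G →+* k :=
    ((Pi.evalAlgHom k (fun _ : G => k) g).comp (coordRing k G).val).toRingHom
  let M : Matrix (Fin s) (Fin s) k := Matrix.of fun i j => lieEval g (z i) (D j)
  have hM : M.det ≠ 0 := by
    have hmap : M = evalAt.mapMatrix (Matrix.of fun i j => δ j (z i)) := by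
      ext i j
      exact hD j (z i)
    rwa [hmap, ← RingHom.map_det]
  have hind : LinearIndependent k fun j => (lieAnnihilator B).mkQ (D j) := by
    refine .of_comp ((lieAnnihilator B).liftQ (LinearMap.pi fun i => lieEval g (z i)) fun E hE =>
      funext fun i => congrArg (fun f => f.1 g) (hE _ (hzB i))) ?_
    exact Matrix.linearIndependent_cols_of_det_ne_zero hM
  simpa using hind.fintype_card_le_finrank

theorem ringKrullDim_eq_finrank_quotient_lieAnnihilator (hfg : B.FG)
    (hB : ∀ g, ∀ b ∈ B, leftTranslate k g b ∈ B) :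
    ringKrullDim B = (Module.finrank k (LieAlg k G ⧸ lieAnnihilator B) : ℕ) := by
  obtain ⟨s, z, hz, hzB, hint, hdim⟩ := exists_algebraicIndependent_isIntegral_adjoin_of_fg hfg
  rw [hdim, (le_finrank_quotient_lieAnnihilator hz hzB).antisymm
    (finrank_quotient_lieAnnihilator_le hB hint)]

end Transcendence

end LieAlgebra

section PolynomialFunctions

variable {k : Type*} [Field k] {V W : Type*} [AddCommGroup V] [Module k V] [AddCommGroup W]
  [Module k W]

theorem isOpen_zariski {X : Type*} {A : Subalgebra k (X → k)} {f : X → k} (hf : f ∈ A) :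
    @IsOpen X (zariski A) {x | f x ≠ 0} :=
  TopologicalSpace.isOpen_generateFrom_of_mem ⟨f, hf, rfl⟩

theorem det_mem {X ι : Type*} [Fintype ι] [DecidableEq ι] {A : Subalgebra k (X → k)}
    {M : X → Matrix ι ι k} (hM : ∀ i j, (fun x => M x i j) ∈ A) : (fun x => (M x).det) ∈ A := by
  let N : Matrix ι ι A := Matrix.of fun i j => ⟨fun x => M x i j, hM i j⟩
  have hN : (fun x => (M x).det) = N.det.1 := funext fun x =>
    (((Pi.evalAlgHom k (fun _ : X => k) x).comp A.val).toRingHom.map_det N).symm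
  exact hN ▸ N.det.2

theorem linearForm_mem_polyFun (ℓ : Module.Dual k V) : (fun v => ℓ v) ∈ polyFun k V :=
  Algebra.subset_adjoin ⟨ℓ, rfl⟩

theorem pullback_mem_polyFun (f : V →ₗ[k] W) {p : W → k} (hp : p ∈ polyFun k W) :
    pullback k f p ∈ polyFun k V := by
  have hle : polyFun k W ≤ (polyFun k V).comap (pullback k f) := by
    refine Algebra.adjoin_le ?_
    rintro _ ⟨ℓ, rfl⟩
    exact linearForm_mem_polyFun (ℓ ∘ₗ f)
  exact hle hp

theorem zariskiDim_le_of_injective {f : V →ₗ[k] W} (hf : Function.Injective f) {S : Set V}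
    {T : Set W} (hST : Set.MapsTo f S T) :
    zariskiDim (polyFun k V) S ≤ zariskiDim (polyFun k W) T := by
  obtain ⟨g, hg⟩ := f.exists_leftInverse_of_injective (LinearMap.ker_eq_bot.2 hf)
  let φ : polyFun k W →ₐ[k] polyFun k V := ((pullback k f).comp (polyFun k W).val).codRestrict _
    fun p => pullback_mem_polyFun f p.2
  have hφ : Function.Surjective φ := fun p => ⟨⟨_, pullback_mem_polyFun g p.2⟩,
    Subtype.ext <| funext fun v => congrArg p.1 (LinearMap.congr_fun hg v)⟩
  exact ringKrullDim_le_of_surjective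
    (Ideal.quotientMap (vanishingIdeal (polyFun k V) S) φ.toRingHom fun p hp v hv =>
      hp _ (hST hv)) (Ideal.quotientMap_surjective hφ)

theorem le_finrank_range_iff_exists_det_ne_zero (f : V →ₗ[k] W) [FiniteDimensional k W] {r : ℕ} :
    r ≤ Module.finrank k f.range ↔ ∃ (v : Fin r → V) (ℓ : Fin r → Module.Dual k W),
      (Matrix.of fun i j => ℓ j (f (v i))).det ≠ 0 := by
  constructor
  · intro hr
    obtain ⟨w, hw⟩ := exists_linearIndependent_of_le_finrank hr
    choose v hv using fun i => (w i).2
    have hfv : LinearIndependent k fun i => f (v i) := by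
      simp only [hv]
      exact hw.map' f.range.subtype f.range.ker_subtype
    obtain ⟨L, hL⟩ := (Fintype.linearCombination k fun i => f (v i)).exists_leftInverse_of_injective
      (LinearMap.ker_eq_bot.2 hfv.fintypeLinearCombination_injective)
    have hLv : ∀ i, L (f (v i)) = Pi.single i 1 := fun i => by
      simpa using LinearMap.congr_fun hL (Pi.single i 1)
    refine ⟨v, fun j => LinearMap.proj j ∘ₗ L, ?_⟩
    have hone : (Matrix.of fun i j => (LinearMap.proj j ∘ₗ L) (f (v i))) =
        (1 : Matrix (Fin r) (Fin r) k) := by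
      ext i j
      simp [hLv, Matrix.one_apply, Pi.single_apply, eq_comm]
    rw [hone, Matrix.det_one]
    exact one_ne_zero
  · rintro ⟨v, ℓ, hdet⟩
    have hrow : LinearIndependent k
        ((LinearMap.pi ℓ ∘ₗ f.range.subtype) ∘ fun i => f.rangeRestrict (v i)) :=
      Matrix.linearIndependent_rows_of_det_ne_zero hdet
    simpa using (LinearIndependent.of_comp _ hrow).fintype_card_le_finrank

theorem isOpen_le_finrank_range {U : Type*} [AddCommGroup U] [Module k U] [FiniteDimensional k W]
    (Φ : V →ₗ[k] U →ₗ[k] W) (r : ℕ) :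
    @IsOpen V (zariski (polyFun k V)) {v | r ≤ Module.finrank k (Φ v).range} := by
  let := zariski (polyFun k V)
  simp only [le_finrank_range_iff_exists_det_ne_zero, Set.ofPred_exists]
  exact isOpen_iUnion fun u => isOpen_iUnion fun ℓ => isOpen_zariski <|
    det_mem fun i j => linearForm_mem_polyFun (ℓ j ∘ₗ Φ.flip (u i))

end PolynomialFunctions

section Orbits

variable {k : Type*} [Field k] {G : Type*} [Group G] [AffineAlgebraicGroup k G]
  {V : Type*} [AddCommGroup V] [Module k V]

section OrbitAlgebra

variable (ρ : Representation k G V) [IsRational ρ] (v : V)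

/-- `ℓ ↦ ℓ (g • v)`, the pull-back of linear forms along the orbit map of `v`. -/
def orbitPullback : Module.Dual k V →ₗ[k] coordRing k G where
  toFun ℓ := coeff ρ ℓ v
  map_add' _ _ := rfl
  map_smul' _ _ := rfl

/-- The algebra of pull-backs of polynomial functions along the orbit map of `v`; it is the
coordinate ring of the closure of the orbit. -/
def orbitAlg : Subalgebra k (coordRing k G) :=
  Algebra.adjoin k (Set.range (orbitPullback ρ v))

theorem leftTranslate_mem_orbitAlg (g : G) {b : coordRing k G} (hb : b ∈ orbitAlg ρ v) :
    leftTranslate k g b ∈ orbitAlg ρ v := by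
  have hle : orbitAlg ρ v ≤ (orbitAlg ρ v).comap (leftTranslate k g) := by
    refine Algebra.adjoin_le ?_
    rintro _ ⟨ℓ, rfl⟩
    refine Algebra.subset_adjoin ⟨ℓ ∘ₗ ρ g, coordRing_ext fun x => ?_⟩
    simp [orbitPullback, coeff]
  exact hle hb

theorem fg_orbitAlg [FiniteDimensional k V] : (orbitAlg ρ v).FG := by
  have hrange : (orbitPullback ρ v).range.FG := Module.Finite.iff_fg.1 inferInstance
  obtain ⟨s, hs⟩ := hrange
  exact ⟨s, by rw [orbitAlg, ← LinearMap.coe_range, ← hs, Algebra.adjoin_span]⟩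

theorem map_pullback_polyFun :
    (polyFun k V).map (pullback k fun g => ρ g v) = (orbitAlg ρ v).map (coordRing k G).val := by
  rw [polyFun, orbitAlg, AlgHom.map_adjoin, AlgHom.map_adjoin, ← Set.range_comp, ← Set.range_comp]
  rfl

theorem orbitDim_eq_ringKrullDim_orbitAlg : orbitDim ρ v = ringKrullDim (orbitAlg ρ v) := by
  let f := ((pullback k fun g => ρ g v).comp (polyFun k V).val).rangeRestrict
  have hrange : ((pullback k fun g => ρ g v).comp (polyFun k V).val).range =
      (orbitAlg ρ v).map (coordRing k G).val := by
    rw [AlgHom.range_comp, Subalgebra.range_val, map_pullback_polyFun]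
  have hker : vanishingIdeal (polyFun k V) (Set.range fun g => ρ g v) = RingHom.ker f := by
    ext p
    refine ⟨fun hp => Subtype.ext (funext fun g => hp _ ⟨g, rfl⟩), ?_⟩
    rintro hp _ ⟨g, rfl⟩
    exact congrFun (congrArg Subtype.val hp) g
  let e := (Ideal.quotientKerAlgEquivOfSurjective (AlgHom.rangeRestrict_surjective _)).trans <|
    (Subalgebra.equivOfEq _ _ hrange).trans
      ((orbitAlg ρ v).equivMapOfInjective _ Subtype.val_injective).symm
  rw [orbitDim, zariskiDim, hker]
  exact ringKrullDim_eq_of_ringEquiv e.toRingEquiv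

end OrbitAlgebra

variable [FiniteDimensional k V]

attribute [local instance 100] LieRing.ofAssociativeRing

/-- `v ↦ (D ↦ D · v)`: the differential at the identity of the orbit map of `v`. -/
noncomputable def orbitDifferential (ρ : Representation k G V) [IsRational ρ] :
    V →ₗ[k] LieAlg k G →ₗ[k] V :=
  LinearMap.flip (differential ρ).toLinearMap

theorem finrank_range_add_finrank_lieStabiliser (ρ : Representation k G V) [IsRational ρ] (v : V) :
    Module.finrank k (orbitDifferential ρ v).range + Module.finrank k (lieStabiliser ρ v) =
      Module.finrank k (LieAlg k G) :=
  (orbitDifferential ρ v).finrank_range_add_finrank_ker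

theorem lieAnnihilator_orbitAlg (ρ : Representation k G V) [IsRational ρ] (v : V) :
    lieAnnihilator (orbitAlg ρ v) = (orbitDifferential ρ v).ker := by
  ext D
  refine ⟨fun hD => lieAct_ext (k := k) fun ℓ => ?_, fun hD b hb => ?_⟩
  · refine (apply_lieAct ρ D v ℓ).trans ?_
    change (D.1 (orbitPullback ρ v ℓ)).1 1 = _
    rw [hD _ (Algebra.subset_adjoin ⟨ℓ, rfl⟩), map_zero]
    rfl
  · have hDv : lieAct ρ D v = 0 := hD
    have hle : orbitAlg ρ v ≤ constants D.1 := by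
      refine Algebra.adjoin_le ?_
      rintro _ ⟨ℓ, rfl⟩
      refine (derivation_coeff ρ D v ℓ).trans (coordRing_ext fun g => ?_)
      simp [coeff, hDv]
    exact hle hb

theorem orbitDim_eq_finrank_range [CharZero k] (ρ : Representation k G V) [IsRational ρ] (v : V) :
    orbitDim ρ v = (Module.finrank k (orbitDifferential ρ v).range : ℕ) := by
  rw [orbitDim_eq_ringKrullDim_orbitAlg, ringKrullDim_eq_finrank_quotient_lieAnnihilator
    (fg_orbitAlg ρ v) fun g b => leftTranslate_mem_orbitAlg ρ v g, lieAnnihilator_orbitAlg,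
    (orbitDifferential ρ v).quotKerEquivRange.finrank_eq]

theorem mem_regularSet_iff [CharZero k] (ρ : Representation k G V) [IsRational ρ] (v : V) :
    v ∈ regularSet ρ ↔
      ∀ w, Module.finrank k (lieStabiliser ρ v) ≤ Module.finrank k (lieStabiliser ρ w) := by
  refine forall_congr' fun w => ?_
  have hv := finrank_range_add_finrank_lieStabiliser ρ v
  have hw := finrank_range_add_finrank_lieStabiliser ρ w
  simp only [orbitDim_eq_finrank_range, Nat.cast_le]
  omega

theorem exists_mem_finrank_lieStabiliser_le (ρ : Representation k G V) [IsRational ρ] {Ω : Set V}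
    (hΩ : @Dense V (zariski (polyFun k V)) Ω) (v : V) :
    ∃ w ∈ Ω, Module.finrank k (lieStabiliser ρ w) ≤ Module.finrank k (lieStabiliser ρ v) := by
  let := zariski (polyFun k V)
  let r := Module.finrank k (orbitDifferential ρ v).range
  obtain ⟨w, hvw : r ≤ _, hw⟩ := hΩ.inter_open_nonempty _
    (isOpen_le_finrank_range (orbitDifferential ρ) r) ⟨v, le_refl r⟩
  have hv := finrank_range_add_finrank_lieStabiliser ρ v
  have hw' := finrank_range_add_finrank_lieStabiliser ρ w
  exact ⟨w, hw, by omega⟩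

/-- The adjoint action as a linear map. -/
def adLinear (g : G) : LieAlg k G →ₗ[k] LieAlg k G where
  toFun := Ad g
  map_add' _ _ := Subtype.ext <| Derivation.ext fun _ => map_add (rightTranslate k g) _ _
  map_smul' c _ := Subtype.ext <| Derivation.ext fun _ => map_smul (rightTranslate k g) c _

theorem finrank_le_of_areConjugate {𝔞 𝔟 : LieSubalgebra k (LieAlg k G)} (h : AreConjugate 𝔞 𝔟) :
    Module.finrank k 𝔟 ≤ Module.finrank k 𝔞 := by
  obtain ⟨g, hg⟩ := h
  have hmap : 𝔟.toSubmodule = 𝔞.toSubmodule.map (adLinear g) := SetLike.coe_injective hg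
  change Module.finrank k 𝔟.toSubmodule ≤ Module.finrank k 𝔞.toSubmodule
  exact hmap ▸ Submodule.finrank_map_le _ _

theorem finrank_le_of_isGenericStabiliser {ρ : Representation k G V} [IsRational ρ]
    {𝔥 : LieSubalgebra k (LieAlg k G)} (h𝔥 : IsGenericStabiliser ρ 𝔥) (v : V) :
    Module.finrank k 𝔥 ≤ Module.finrank k (lieStabiliser ρ v) := by
  obtain ⟨Ω, -, hΩ, hconj, u, hu, rfl⟩ := h𝔥
  obtain ⟨w, hw, hwv⟩ := exists_mem_finrank_lieStabiliser_le ρ hΩ v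
  exact (finrank_le_of_areConjugate (hconj w hw u hu)).trans hwv

theorem mem_regularSet_iff_of_isGenericStabiliser [CharZero k] {ρ : Representation k G V}
    [IsRational ρ] {𝔥 : LieSubalgebra k (LieAlg k G)} (h𝔥 : IsGenericStabiliser ρ 𝔥) (v : V) :
    v ∈ regularSet ρ ↔ Module.finrank k (lieStabiliser ρ v) ≤ Module.finrank k 𝔥 := by
  have hmin := finrank_le_of_isGenericStabiliser h𝔥
  rw [mem_regularSet_iff]
  refine ⟨fun hv => ?_, fun hv w => hv.trans (hmin w)⟩
  obtain ⟨Ω, -, -, -, u, -, rfl⟩ := h𝔥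
  exact hv u

end Orbits

section Morphisms

variable {k : Type*} [Field k] {G K : Type*} [Group G] [Group K] [AffineAlgebraicGroup k G]
  [AffineAlgebraicGroup k K]

variable (k) in
/-- A group homomorphism between affine algebraic groups is regular if it pulls regular functions
back to regular functions. -/
def IsRegularHom (φ : G →* K) : Prop :=
  ∀ f ∈ coordRing k K, (fun g => f (φ g)) ∈ coordRing k G

/-- The comorphism `k[K] → k[G]` of a regular homomorphism `G → K`. -/
def comorphism {φ : G →* K} (hφ : IsRegularHom k φ) : coordRing k K →ₐ[k] coordRing k G :=
  ((pullback k φ).comp (coordRing k K).val).codRestrict _ fun f => hφ f f.2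

theorem comorphism_apply {φ : G →* K} (hφ : IsRegularHom k φ) (f : coordRing k K) (g : G) :
    (comorphism hφ f).1 g = f.1 (φ g) := rfl

/-- The differential `Lie G → Lie K` of a regular homomorphism. It is defined through tangent
vectors at the identity, since left invariant derivations do not push forward directly. -/
noncomputable def lieMap {φ : G →* K} (hφ : IsRegularHom k φ) : LieAlg k G →ₗ[k] LieAlg k K where
  toFun D := leftInvariantDerivation
    { toFun f := (D.1 (comorphism hφ f)).1 1
      map_add' a b := by simp
      map_smul' c a := by simp }
    fun a b => by simp [comorphism_apply]
  map_add' _ _ := rfl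
  map_smul' _ _ := rfl

theorem lieMap_apply_one {φ : G →* K} (hφ : IsRegularHom k φ) (D : LieAlg k G)
    (f : coordRing k K) : ((lieMap hφ D).1 f).1 1 = (D.1 (comorphism hφ f)).1 1 := by
  change (D.1 (comorphism hφ (leftTranslate k 1 f))).1 1 = _
  rw [leftTranslate_one]

theorem lieMap_injective {φ : G →* K} {hφ : IsRegularHom k φ}
    (hsurj : Function.Surjective (comorphism hφ)) : Function.Injective (lieMap hφ) := by
  refine fun D E h => lieAlg_ext fun f => ?_
  obtain ⟨F, rfl⟩ := hsurj f
  rw [← lieMap_apply_one, ← lieMap_apply_one, h]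

section Equivariant

variable {X Y : Type*} [AddCommGroup X] [Module k X] [FiniteDimensional k X] [AddCommGroup Y]
  [Module k Y] [FiniteDimensional k Y] {τ : Representation k K X} {ρ : Representation k G Y}
  [IsRational τ] [IsRational ρ] {φ : G →* K} (hφ : IsRegularHom k φ) {e : X →ₗ[k] Y}

theorem map_lieAct_lieMap (he : ∀ g x, e (τ (φ g) x) = ρ g (e x)) (D : LieAlg k G) (x : X) :
    e (lieAct τ (lieMap hφ D) x) = lieAct ρ D (e x) := by
  refine lieAct_ext (k := k) fun ℓ => ?_
  have hcoeff : comorphism hφ (coeff τ (ℓ ∘ₗ e) x) = coeff ρ ℓ (e x) :=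
    coordRing_ext fun g => congrArg ℓ (he g x)
  rw [apply_lieAct, ← hcoeff, ← lieMap_apply_one]
  exact apply_lieAct τ (lieMap hφ D) x (ℓ ∘ₗ e)

theorem finrank_lieStabiliser_map_le (hsurj : Function.Surjective (comorphism hφ))
    (he : ∀ g x, e (τ (φ g) x) = ρ g (e x)) (hinj : Function.Injective e) (x : X) :
    Module.finrank k (lieStabiliser ρ (e x)) ≤ Module.finrank k (lieStabiliser τ x) := by
  let S := (lieStabiliser ρ (e x)).toSubmodule
  let T := (lieStabiliser τ x).toSubmodule
  have hST : S.map (lieMap hφ) ≤ T := Submodule.map_le_iff_le_comap.2 fun D hD =>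
    hinj ((map_lieAct_lieMap hφ he D x).trans (hD.trans e.map_zero.symm))
  calc Module.finrank k S
      = Module.finrank k (S.map (lieMap hφ)) :=
        (S.equivMapOfInjective _ (lieMap_injective hsurj)).finrank_eq
    _ ≤ Module.finrank k T := Submodule.finrank_mono hST

end Equivariant

end Morphisms

section Comparison

variable {k : Type*} [Field k] {G H : Type*} [Group G] [Group H] {V W : Type*} [AddCommGroup V]
  [Module k V] [AddCommGroup W] [Module k W] {d : ℕ}

/-- The isomorphism `V ⊗ W ≃ V^d` given by a basis of `W`. -/
noncomputable def tensorEquivPow (V : Type*) [AddCommGroup V] [Module k V]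
    (b : Module.Basis (Fin d) k W) : V ⊗[k] W ≃ₗ[k] (Fin d → V) :=
  (TensorProduct.equivFinsuppOfBasisRight b).trans (Finsupp.linearEquivFunOnFinite k V (Fin d))

theorem tensorEquivPow_tmul (b : Module.Basis (Fin d) k W) (v : V) (w : W) (i : Fin d) :
    tensorEquivPow V b (v ⊗ₜ w) i = b.repr w i • v := by
  simp [tensorEquivPow]

theorem tensorEquivPow_boxTensor_inl (b : Module.Basis (Fin d) k W) (ρ : Representation k G V)
    (σ : Representation k H W) (g : G) (x : V ⊗[k] W) :
    tensorEquivPow V b (boxTensor ρ σ (MonoidHom.inl G H g) x) =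
      powRep ρ d g (tensorEquivPow V b x) := by
  induction x with
  | zero => simp
  | add x y hx hy => simp only [map_add, hx, hy]
  | tmul v w =>
    have hinl : boxTensor ρ σ (MonoidHom.inl G H g) (v ⊗ₜ w) = ρ g v ⊗ₜ w := by
      simp [boxTensor]
    funext i
    change _ = ρ g (tensorEquivPow V b (v ⊗ₜ w) i)
    rw [hinl, tensorEquivPow_tmul, tensorEquivPow_tmul, map_smul]

variable [AffineAlgebraicGroup k G] [AffineAlgebraicGroup k H]

variable (k G H) in
theorem isRegularHom_inl : IsRegularHom k (MonoidHom.inl G H) := fun _ hf =>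
  pullback_mem_of_prodAlg (MonoidHom.inl G H) (fun _ ha => ha) (fun b _ => const_mem _ (b 1)) hf

theorem comorphism_inl_surjective : Function.Surjective (comorphism (isRegularHom_inl k G H)) :=
  fun f => ⟨⟨_, fst_mem f.2⟩, rfl⟩

variable [FiniteDimensional k V] [FiniteDimensional k W]

theorem finrank_lieStabiliser_powRep_le (b : Module.Basis (Fin d) k W) (ρ : Representation k G V)
    (σ : Representation k H W) [IsRational ρ] [IsRational σ] (x : V ⊗[k] W) :
    Module.finrank k (lieStabiliser (powRep ρ d) (tensorEquivPow V b x)) ≤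
      Module.finrank k (lieStabiliser (boxTensor ρ σ) x) :=
  finrank_lieStabiliser_map_le (e := (tensorEquivPow V b).toLinearMap) (isRegularHom_inl k G H)
    comorphism_inl_surjective (tensorEquivPow_boxTensor_inl b ρ σ) (tensorEquivPow V b).injective x

theorem tensorEquivPow_mem_regularSet [CharZero k] (b : Module.Basis (Fin d) k W)
    {ρ : Representation k G V} {σ : Representation k H W} [IsRational ρ] [IsRational σ]
    {𝔥 : LieSubalgebra k (LieAlg k (G × H))} (h𝔥 : IsGenericStabiliser (boxTensor ρ σ) 𝔥)
    {𝔥₁ : LieSubalgebra k (LieAlg k G)} (h𝔥₁ : IsGenericStabiliser (powRep ρ d) 𝔥₁)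
    (hle : Module.finrank k 𝔥 ≤ Module.finrank k 𝔥₁) {x : V ⊗[k] W}
    (hx : x ∈ regularSet (boxTensor ρ σ)) :
    tensorEquivPow V b x ∈ regularSet (powRep ρ d) := by
  rw [mem_regularSet_iff_of_isGenericStabiliser h𝔥] at hx
  rw [mem_regularSet_iff_of_isGenericStabiliser h𝔥₁]
  calc Module.finrank k (lieStabiliser (powRep ρ d) (tensorEquivPow V b x))
      ≤ Module.finrank k (lieStabiliser (boxTensor ρ σ) x) :=
        finrank_lieStabiliser_powRep_le b ρ σ x
    _ ≤ Module.finrank k 𝔥 := hx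
    _ ≤ Module.finrank k 𝔥₁ := hle

end Comparison

end CodimTwo

theorem mainTheorem9_general
    {k : Type*} [Field k] [CharZero k] {G₁ G₂ : Type*} [Group G₁] [Group G₂]
    [AffineAlgebraicGroup k G₁] [AffineAlgebraicGroup k G₂]
    {V₁ V₂ : Type*} [AddCommGroup V₁] [Module k V₁] [FiniteDimensional k V₁]
    [AddCommGroup V₂] [Module k V₂] [FiniteDimensional k V₂]
    (ρ₁ : Representation k G₁ V₁) (ρ₂ : Representation k G₂ V₂) [IsRational ρ₁] [IsRational ρ₂]
    {n : ℕ} (hC : CodimCondition n (boxTensor ρ₁ ρ₂))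
    {𝔥 : LieSubalgebra k (LieAlg k (G₁ × G₂))} (h𝔥 : IsGenericStabiliser (boxTensor ρ₁ ρ₂) 𝔥)
    {𝔥₁ : LieSubalgebra k (LieAlg k G₁)}
    (h𝔥₁ : IsGenericStabiliser (powRep ρ₁ (Module.finrank k V₂)) 𝔥₁)
    (hle : Module.finrank k 𝔥 ≤ Module.finrank k 𝔥₁) :
    CodimCondition n (powRep ρ₁ (Module.finrank k V₂)) := by
  let e := tensorEquivPow V₁ (Module.finBasis k V₂)
  have hmaps : Set.MapsTo e.symm (regularSet (powRep ρ₁ (Module.finrank k V₂)))ᶜ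
      (regularSet (boxTensor ρ₁ ρ₂))ᶜ := fun w hw hreg =>
    hw (e.apply_symm_apply w ▸ tensorEquivPow_mem_regularSet _ h𝔥 h𝔥₁ hle hreg)
  have hdim := zariskiDim_le_of_injective (f := e.symm.toLinearMap) e.symm.injective hmaps
  rw [CodimCondition, ← e.finrank_eq]
  exact (add_le_add_left hdim _).trans hC

theorem mainTheorem9
    {k : Type*} [Field k] [IsAlgClosed k] [CharZero k]
    {G₁ G₂ : Type*} [Group G₁] [Group G₂]
    [AffineAlgebraicGroup k G₁] [AffineAlgebraicGroup k G₂]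
    (hG₁ : IsZariskiConnected k G₁) (hG₂ : IsZariskiConnected k G₂)
    {V₁ V₂ : Type*} [AddCommGroup V₁] [Module k V₁] [FiniteDimensional k V₁]
    [AddCommGroup V₂] [Module k V₂] [FiniteDimensional k V₂]
    (ρ₁ : Representation k G₁ V₁) (ρ₂ : Representation k G₂ V₂)
    [IsRational ρ₁] [IsRational ρ₂]
    (hC : CodimCondition 2 (boxTensor ρ₁ ρ₂))
    (𝔥 : LieSubalgebra k (LieAlg k (G₁ × G₂)))
    (h𝔥 : IsGenericStabiliser (boxTensor ρ₁ ρ₂) 𝔥)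
    (𝔥₁ : LieSubalgebra k (LieAlg k G₁))
    (h𝔥₁ : IsGenericStabiliser (powRep ρ₁ (Module.finrank k V₂)) 𝔥₁)
    (heq : Nonempty (𝔥 ≃ₗ⁅k⁆ 𝔥₁)) :
    CodimCondition 2 (powRep ρ₁ (Module.finrank k V₂)) := by
  obtain ⟨φ⟩ := heq
  exact mainTheorem9_general ρ₁ ρ₂ hC h𝔥 h𝔥₁ φ.toLinearEquiv.finrank_eq.le
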